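/- Let $2\le d\le n$ be integers. Let $G(n,d)$ be the Grassmannian of $d$-dimensional linear subspaces of $\mathbf R^n$, with its usual topology and its $O(n)$-invariant Borel probability measure $\gamma_{n,d}$. Let $\mathscr H^d$ be the $d$-dimensional Hausdorff measure, normalized to agree with Lebesgue measure on $\mathbf R^d$. Write $\Theta^d(\mu,y)=\lim_{r\to0+}\mu(\bar B(y,r))/(\alpha(d)r^d)$ for the $d$-dimensional density, where $\alpha(d)$ is the volume of the unit ball of $\mathbf R^d$, and $\mathrm{Tan}^d(\mu,y)=\bigcap\{\mathrm{Tan}(A,y): A\subseteq\mathbf R^n,\ \Theta^d(\mu\llcorner(\mathbf R^n\setminus A),y)=0\}$ for the approximate tangent cone, where $\mathrm{Tan}(A,y)$ is the tangent cone of $A$ at $y$. A *$\mathscr C^0$ integrand* is a continuous function $F:\mathbf R^n\times G(n,d)\to(0,\infty)$; for $x\in\mathbf R^n$ the frozen integrand is $F^x(y,T)=F(x,T)$. A *$d$-set* is an $\mathscr H^d$-measurable set $S\subseteq\mathbf R^n$ with $\mathscr H^d(S\cap K)<\infty$ for every compact $K$. For a $d$-set $S$ put $\mathcal R(S)=\{y\in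 S:\Theta^d(\mathscr H^d\llcorner S,y)=1\}$, $\mathcal U(S)=S\setminus\mathcal R(S)$ and $$\Phi_F(S)=\int_{\mathcal R(S)}F\bigl(y,\mathrm{Tan}^d(\mathscr H^d\llcorner\mathcal R(S),y)\bigr)\,d\mathscr H^d(y)+\int_{\mathcal U(S)}\int F(y,T)\,d\gamma_{n,d}(T)\,d\mathscr H^d(y)$$ (the approximate tangent cone is a $d$-plane for $\mathscr H^d$-almost all $y\in\mathcal R(S)$); for all other sets put $\Phi_F(S)=\infty$. Let $Q_0=[-1,1]^d\subseteq\mathbf R^d$. A pair $(S,Q)$ of subsets of $\mathbf R^n$ is a *cubical test pair* if there is an orthogonal projection $p:\mathbf R^n\to\mathbf R^d$ (i.e. a linear map with $p\circ p^*=\mathrm{id}$) such that $Q=p^*[Q_0]$ and, with $B=p^*[\partial Q_0]$, - $S$ is compact, $\mathscr H^d(S)<\infty$, $\mathscr H^d$-almost all of $S$ is covered by countably many Lipschitz images of $\mathbf R^d$, and $B\subseteq S$; - $f[S]\ne B$ for every Lipschitz map $f:\mathbf R^n\to\mathbf R^n$ with $f(y)=y$ for all $y\in B$. **Lemma.** Let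 $F$ be a $\mathscr C^0$ integrand, $x\in\mathbf R^n$, and $(R,Q)$ a cubical test pair. If $\Phi_{F^x}(R)<\Phi_{F^x}(Q)$, then $\mathscr H^d(R)>\mathscr H^d(Q)$. -/

import Mathlib

open MeasureTheory Measure Set Filter Topology Metric
open scoped ENNReal NNReal

noncomputable section

namespace AlmgrenElliptic

/-- `ℝⁿ` with its Euclidean norm. -/
abbrev Eucl (n : ℕ) : Type := EuclideanSpace ℝ (Fin n)

/-! ### The Grassmannian and its invariant probability measure -/

/-- The Grassmannian `G(n,d)` of `d`-dimensional linear subspaces of `ℝⁿ`. -/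
def Grass (n d : ℕ) : Type :=
  {T : Submodule ℝ (Eucl n) // Module.finrank ℝ T = d}

/-- The usual topology of `G(n,d)`, given by the metric `‖P_S - P_T‖`, where `P_T` is the orthogonal
projection of `ℝⁿ` onto `T`. -/
instance (n d : ℕ) : TopologicalSpace (Grass n d) :=
  TopologicalSpace.induced (fun T : Grass n d => T.1.starProjection) inferInstance

instance (n d : ℕ) : MeasurableSpace (Grass n d) := borel _

instance (n d : ℕ) : BorelSpace (Grass n d) := ⟨rfl⟩

/-- The orthogonal group `O(n)`. -/
abbrev OrthGroup (n : ℕ) : Type := unitary (Eucl n →L[ℝ] Eucl n)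

instance (n : ℕ) : ContinuousStar (Eucl n →L[ℝ] Eucl n) :=
  ⟨(ContinuousLinearMap.adjoint (𝕜 := ℝ) (E := Eucl n) (F := Eucl n)).continuous⟩

instance (n : ℕ) : CompactSpace (OrthGroup n) := by
  have : ProperSpace (Eucl n →L[ℝ] Eucl n) := FiniteDimensional.proper ℝ _
  refine isCompact_iff_compactSpace.mp ?_
  refine Metric.isCompact_of_isClosed_isBounded isClosed_unitary ?_
  refine (Metric.isBounded_closedBall (x := (0 : Eucl n →L[ℝ] Eucl n)) (r := 1)).subset ?_
  intro U hU
  rw [mem_closedBall_zero_iff]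
  rcases subsingleton_or_nontrivial (Eucl n →L[ℝ] Eucl n) with h | h
  · simp [Subsingleton.elim U 0]
  · exact (CStarRing.norm_of_mem_unitary hU).le

theorem orthGroup_injective {n : ℕ} (g : OrthGroup n) :
    Function.Injective (g.1 : Eucl n →ₗ[ℝ] Eucl n) := by
  intro x y h
  have h1 : (star g.1 * g.1) x = (star g.1 * g.1) y :=
    congrArg (star g.1 : Eucl n →L[ℝ] Eucl n) h
  simpa [Unitary.star_mul_self_of_mem g.2] using h1

/-- The image `g[T]` of a `d`-plane `T` under an orthogonal map `g`. -/
def Grass.rotate {n d : ℕ} (g : OrthGroup n) (T : Grass n d) : Grass n d :=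
  ⟨T.1.map (g.1 : Eucl n →ₗ[ℝ] Eucl n),
    (Submodule.equivMapOfInjective _ (orthGroup_injective g) T.1).finrank_eq.symm.trans T.2⟩

open Classical in
/-- The `O(n)`-invariant probability measure `γ_{n,d}` on `G(n,d)`: the image of the normalized Haar
measure of `O(n)` under `g ↦ g[T]`, where `T` is any `d`-plane. (If `d > n`, then `G(n,d)` is empty,
and so is the measure.) -/
def grassHaar (n d : ℕ) : Measure (Grass n d) :=
  if h : Nonempty (Grass n d) then
    (haarMeasure (⊤ : TopologicalSpace.PositiveCompacts (OrthGroup n))).map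
      (fun g => Grass.rotate g h.some)
  else 0

/-! ### Densities, approximate tangent cones, rectifiability

`μHE[d]` is the `d`-dimensional Hausdorff measure, normalized so that it is Lebesgue measure
on `ℝᵈ`. -/

/-- The `d`-dimensional density `Θᵈ(μ,a) = lim_{r → 0+} μ(B(a,r)) / (α(d) rᵈ)` exists and equals
`θ`; here `B(a,r)` is the closed ball and `α(d)` is the volume of the unit ball of `ℝᵈ`. -/
def HasDensity {n : ℕ} (d : ℕ) (μ : Measure (Eucl n)) (a : Eucl n) (θ : ℝ≥0∞) : Prop :=
  Tendsto
    (fun r : ℝ => μ (closedBall a r) /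
      ((volume : Measure (Eucl d)) (closedBall 0 1) * ENNReal.ofReal (r ^ d)))
    (𝓝[>] 0) (𝓝 θ)

/-- The cone `Tanᵈ(μ,a)` of `(μ,d)`-approximate tangent vectors at `a`: the intersection of the
tangent cones `Tan(A,a)` over all sets `A` such that the restriction of `μ` to the complement
of `A` has `d`-dimensional density zero at `a`. -/
def approxTan {n : ℕ} (d : ℕ) (μ : Measure (Eucl n)) (a : Eucl n) : Set (Eucl n) :=
  ⋂ (A : Set (Eucl n)) (_ : HasDensity d (μ.restrict Aᶜ) a 0), posTangentConeAt A a

/-- `S` is a `d`-set: it is `ℋᵈ`-measurable (in the sense of Carathéodory) and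
`ℋᵈ(S ∩ K) < ∞` for every compact `K`. -/
def IsDSet {n : ℕ} (d : ℕ) (S : Set (Eucl n)) : Prop :=
  (μHE[d] : Measure (Eucl n)).toOuterMeasure.IsCaratheodory S ∧
    ∀ K : Set (Eucl n), IsCompact K → μHE[d] (S ∩ K) < ∞

/-- `S` is `(ℋᵈ,d)`-rectifiable: `ℋᵈ(S) < ∞` and `ℋᵈ`-almost all of `S` is covered by countably
many Lipschitz images of `ℝᵈ`. -/
def IsRectifiable {n : ℕ} (d : ℕ) (S : Set (Eucl n)) : Prop :=
  μHE[d] S < ∞ ∧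
    ∃ f : ℕ → Eucl d → Eucl n, (∀ i, ∃ K : ℝ≥0, LipschitzWith K (f i)) ∧
      μHE[d] (S \ ⋃ i, range (f i)) = 0

/-! ### Integrands and their energies -/

/-- A `𝒞⁰` integrand: a continuous function `ℝⁿ × G(n,d) → (0,∞)`. -/
def IsIntegrand {n d : ℕ} (F : Eucl n × Grass n d → ℝ) : Prop :=
  Continuous F ∧ ∀ z, 0 < F z

/-- The frozen integrand `Fˣ(y,T) = F(x,T)`. -/
def frozen {n d : ℕ} (F : Eucl n × Grass n d → ℝ) (x : Eucl n) : Eucl n × Grass n d → ℝ :=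
  fun z => F (x, z.2)

/-- `ℛ(S)`: the points of `S` at which `ℋᵈ ⌞ S` has density `1`. -/
def regPart {n : ℕ} (d : ℕ) (S : Set (Eucl n)) : Set (Eucl n) :=
  {y ∈ S | HasDensity d (μHE[d].restrict S) y 1}

/-- `𝒰(S) = S ∖ ℛ(S)`. -/
def unrectPart {n : ℕ} (d : ℕ) (S : Set (Eucl n)) : Set (Eucl n) :=
  S \ regPart d S

open Classical in
/-- The value `F(y, C)` if the cone `C` is a `d`-plane, and `0` otherwise. For a `d`-set `S` the cone
`Tanᵈ(ℋᵈ ⌞ ℛ(S), y)` is a `d`-plane for `ℋᵈ`-almost all `y ∈ ℛ(S)`, so the second case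
only matters on a null set in `Phi` below. -/
def evalCone {n d : ℕ} (F : Eucl n × Grass n d → ℝ) (y : Eucl n) (C : Set (Eucl n)) : ℝ≥0∞ :=
  if h : ∃ T : Grass n d, (T.1 : Set (Eucl n)) = C then ENNReal.ofReal (F (y, h.choose)) else 0

open Classical in
/-- The energy `Φ_F(S)`: the integral of `F` against the varifold of the `d`-set `S`, that is
`∫_{ℛ(S)} F(y, Tanᵈ(ℋᵈ ⌞ ℛ(S), y)) dℋᵈ(y) + ∫_{𝒰(S)} ∫ F(y,T) dγ_{n,d}(T) dℋᵈ(y)`,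
and `∞` if `S` is not a `d`-set. -/
def Phi {n d : ℕ} (F : Eucl n × Grass n d → ℝ) (S : Set (Eucl n)) : ℝ≥0∞ :=
  if IsDSet d S then
    (∫⁻ y in regPart d S, evalCone F y (approxTan d (μHE[d].restrict (regPart d S)) y) ∂μHE[d]) +
      ∫⁻ y in unrectPart d S, (∫⁻ T, ENNReal.ofReal (F (y, T)) ∂(grassHaar n d)) ∂μHE[d]
  else ∞

/-! ### Cubical test pairs -/

/-- The cube `Q₀ = [-1,1]ᵈ` in `ℝᵈ`. -/
def stdCube (d : ℕ) : Set (Eucl d) := {y | ∀ i, y i ∈ Icc (-1 : ℝ) 1}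

/-- `(S,Q)` is a cubical test pair. Here `p` is an orthogonal projection of `ℝⁿ` onto `ℝᵈ`
(`p ∘ p* = id`), and `B = p*[∂Q₀]` is the boundary of the cube `Q = p*[Q₀]`. The condition on `f`
says that `B` is not a Lipschitz retract of `S`; it is meant for sets `S` that contain `B`, for
otherwise it would hold for the empty set. -/
def IsCubicalTestPair {n : ℕ} (d : ℕ) (S Q : Set (Eucl n)) : Prop :=
  ∃ p : Eucl n →L[ℝ] Eucl d, p ∘L p.adjoint = ContinuousLinearMap.id ℝ (Eucl d) ∧
    Q = p.adjoint '' stdCube d ∧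
    IsCompact S ∧ IsRectifiable d S ∧
    p.adjoint '' frontier (stdCube d) ⊆ S ∧
    ∀ f : Eucl n → Eucl n, (∃ K : ℝ≥0, LipschitzWith K f) →
      (∀ y ∈ p.adjoint '' frontier (stdCube d), f y = y) →
      f '' S ≠ p.adjoint '' frontier (stdCube d)

end AlmgrenElliptic

end

namespace AlmgrenElliptic

/-! ### Hausdorff measure and orthogonal projections -/

/-! Suppose `R` has no more area than `Q`. A hole in the shadow `p '' R` inside the cube would allow
a radial retraction of `R` onto `B`, so the shadow contains the cube
(`IsCubicalTestPair.cube_subset_proj`). As `p` is 1-Lipschitz, `R` and `Q` have equal area, and `p`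
cannot lose area anywhere: the part of `R` over a Borel set `E` has area at most `volume E`
(`measure_inter_preimage_le`).

This rigidity forces `R` to be horizontal almost everywhere. Up to a set with null shadow, `R` is a
countable union of Lipschitz graphs of vertical maps `u`. Tilting `p` by a small `t` raises its
Lipschitz constant only to order `t ^ 2`, whereas the Jacobian of the tilted projection along a
graph changes by `t` times an entry of `Du`. Both signs of `t` together give `Du = 0`
(`ae_hasFDerivAt_zero`).

At density points with `Du = 0` the area measure of `R` has density 1, and its approximate tangent
cone is the range of `p.adjoint` (`IsHorizAt`). Hence the frozen energy of `R` is `F (x, T)` times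
its area, with `T` the plane of `Q`. The same holds for `Q`, so the energies agree, contrary to the
strict inequality. -/

theorem euclideanHausdorffMeasure_image_le {X Y : Type*} [EMetricSpace X] [MeasurableSpace X]
    [BorelSpace X] [EMetricSpace Y] [MeasurableSpace Y] [BorelSpace Y] {K : ℝ≥0} {f : X → Y}
    (hf : LipschitzWith K f) (d : ℕ) (s : Set X) :
    μHE[d] (f '' s) ≤ (K : ℝ≥0∞) ^ d * μHE[d] s := by
  have h := hf.hausdorffMeasure_image_le (Nat.cast_nonneg d) s
  rw [ENNReal.rpow_natCast] at h
  simp only [euclideanHausdorffMeasure_def, Measure.smul_apply, ENNReal.smul_def, smul_eq_mul]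
  rw [mul_left_comm]
  gcongr

theorem volume_image_le {n d : ℕ} {K : ℝ≥0} {f : Eucl n → Eucl d}
    (hf : LipschitzWith K f) (s : Set (Eucl n)) :
    volume (f '' s) ≤ (K : ℝ≥0∞) ^ d * μHE[d] s := by
  rw [← EuclideanSpace.euclideanHausdorffMeasure_eq_volume]
  exact euclideanHausdorffMeasure_image_le hf d s

section Projection

variable {n d : ℕ} {p : Eucl n →L[ℝ] Eucl d}

theorem proj_adjoint (hp : p ∘L p.adjoint = ContinuousLinearMap.id ℝ (Eucl d)) (z : Eucl d) :
    p (p.adjoint z) = z := congrArg (fun L : Eucl d →L[ℝ] Eucl d => L z) hp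

theorem norm_adjoint (hp : p ∘L p.adjoint = ContinuousLinearMap.id ℝ (Eucl d)) (z : Eucl d) :
    ‖p.adjoint z‖ = ‖z‖ := by
  have h : inner ℝ (p.adjoint z) (p.adjoint z) = inner ℝ z z := by
    rw [ContinuousLinearMap.adjoint_inner_left, proj_adjoint hp]
  rw [real_inner_self_eq_norm_sq, real_inner_self_eq_norm_sq] at h
  exact (sq_eq_sq₀ (norm_nonneg _) (norm_nonneg _)).1 h

theorem isometry_adjoint (hp : p ∘L p.adjoint = ContinuousLinearMap.id ℝ (Eucl d)) :
    Isometry p.adjoint :=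
  AddMonoidHomClass.isometry_of_norm p.adjoint (norm_adjoint hp)

theorem norm_sq_eq_proj (hp : p ∘L p.adjoint = ContinuousLinearMap.id ℝ (Eucl d)) (x : Eucl n) :
    ‖x‖ ^ 2 = ‖p x‖ ^ 2 + ‖x - p.adjoint (p x)‖ ^ 2 := by
  have h : inner ℝ (p.adjoint (p x)) (x - p.adjoint (p x)) = 0 := by
    rw [ContinuousLinearMap.adjoint_inner_left, map_sub, proj_adjoint hp, sub_self,
      inner_zero_right]
  have h2 := norm_add_sq_eq_norm_sq_add_norm_sq_real h
  rw [add_sub_cancel, norm_adjoint hp] at h2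
  nlinarith

theorem norm_proj_le (hp : p ∘L p.adjoint = ContinuousLinearMap.id ℝ (Eucl d)) (x : Eucl n) :
    ‖p x‖ ≤ ‖x‖ := by
  have := norm_sq_eq_proj hp x
  exact abs_le_of_sq_le_sq' (by nlinarith [sq_nonneg ‖x - p.adjoint (p x)‖]) (norm_nonneg x) |>.2

theorem lipschitzWith_proj (hp : p ∘L p.adjoint = ContinuousLinearMap.id ℝ (Eucl d)) :
    LipschitzWith 1 p :=
  LipschitzWith.of_dist_le_mul fun x y => by
    simpa [dist_eq_norm] using norm_proj_le hp (x - y)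

theorem volume_proj_image_le (hp : p ∘L p.adjoint = ContinuousLinearMap.id ℝ (Eucl d))
    (s : Set (Eucl n)) : volume (p '' s) ≤ μHE[d] s := by
  simpa using volume_image_le (lipschitzWith_proj hp) s

theorem euclideanHausdorffMeasure_adjoint_image
    (hp : p ∘L p.adjoint = ContinuousLinearMap.id ℝ (Eucl d)) (s : Set (Eucl d)) :
    μHE[d] (p.adjoint '' s) = volume s := by
  rw [(isometry_adjoint hp).euclideanHausdorffMeasure_image,
    EuclideanSpace.euclideanHausdorffMeasure_eq_volume]

/-- If `R` has no more area than a part `P` of its shadow, then the projection preserves area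
on `R`. -/
theorem measure_inter_preimage_le (hp : p ∘L p.adjoint = ContinuousLinearMap.id ℝ (Eucl d))
    {R : Set (Eucl n)} {P : Set (Eucl d)} (hP : P ⊆ p '' R) (hRP : μHE[d] R ≤ volume P)
    (hfin : μHE[d] R ≠ ∞) {E : Set (Eucl d)} (hE : MeasurableSet E) :
    μHE[d] (R ∩ p ⁻¹' E) ≤ volume E := by
  have hm : MeasurableSet (p ⁻¹' E) := p.continuous.measurable hE
  have h1 : μHE[d] (R ∩ p ⁻¹' E) + μHE[d] (R \ p ⁻¹' E) = μHE[d] R :=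
    measure_inter_add_sdiff R hm
  have h2 : volume (P ∩ E) + volume (P \ E) = volume P := measure_inter_add_sdiff P hE
  have h3 : volume (P \ E) ≤ μHE[d] (R \ p ⁻¹' E) := by
    refine (measure_mono ?_).trans (volume_proj_image_le hp _)
    rintro z ⟨hz, hzE⟩
    obtain ⟨y, hy, rfl⟩ := hP hz
    exact ⟨y, ⟨hy, hzE⟩, rfl⟩
  have hf : μHE[d] (R \ p ⁻¹' E) ≠ ∞ := ne_top_of_le_ne_top hfin (measure_mono sdiff_subset)
  -- Excess area over `E` would need a deficit off `E`, which `h3` excludes.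
  refine (ENNReal.add_le_add_iff_right hf).1 ?_
  calc μHE[d] (R ∩ p ⁻¹' E) + μHE[d] (R \ p ⁻¹' E) ≤ volume (P ∩ E) + volume (P \ E) := by
        rw [h1, h2]; exact hRP
    _ ≤ volume E + μHE[d] (R \ p ⁻¹' E) := by
        gcongr
        exact inter_subset_right

end Projection

/-! ### Radial retraction onto the boundary of a convex body -/

/-- Dividing `x - z` by the gauge of the body centred at `z` is Lipschitz away from the centre,
since the gauge is Lipschitz and bounded below by a multiple of the norm. Inside the small ball any
Lipschitz extension will do. -/
theorem exists_lipschitz_retraction_frontier {E : Type*} [NormedAddCommGroup E]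
    [NormedSpace ℝ E] [FiniteDimensional ℝ E] {C : Set E} (hC : Convex ℝ C)
    (hb : Bornology.IsBounded C) {z : E} (hz : z ∈ interior C) {ε : ℝ} (hε : 0 < ε) :
    ∃ ρ : E → E, (∃ K : ℝ≥0, LipschitzWith K ρ) ∧
      ∀ x ∉ ball z ε, ρ x ∈ frontier C ∧ (x ∈ frontier C → ρ x = x) := by
  set D : Set E := (fun x => z + x) ⁻¹' C with hD
  have hDc : Convex ℝ D := hC.translate_preimage_right z
  have hfr : ∀ x, z + x ∈ frontier C ↔ x ∈ frontier D := fun x => by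
    have := (Homeomorph.addLeft z).preimage_frontier C
    exact (Set.ext_iff.1 this x)
  have hD0 : D ∈ 𝓝 (0 : E) := by
    refine (continuous_const.add continuous_id).continuousAt.preimage_mem_nhds ?_
    simpa using mem_interior_iff_mem_nhds.1 hz
  obtain ⟨M, hM0, hM⟩ : ∃ M, 0 < M ∧ D ⊆ closedBall 0 M := by
    obtain ⟨M, hM0, hM⟩ := hb.subset_closedBall_lt 0 z
    refine ⟨M, hM0, fun x hx => ?_⟩
    simpa using hM hx
  have habs : Absorbent ℝ D := absorbent_nhds_zero hD0
  obtain ⟨L, hL⟩ := hDc.lipschitz_gauge hD0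
  have hg : ∀ x : E, ‖x‖ ≤ M * gauge D x := fun x => by
    have := le_gauge_of_subset_closedBall (x := x) habs hM0.le hM
    rwa [div_le_iff₀' hM0] at this
  have hLip : LipschitzOnWith (Real.toNNReal (M / ε * (1 + M * L)))
      (fun x => z + (gauge D (x - z))⁻¹ • (x - z)) (ball z ε)ᶜ := by
    refine LipschitzOnWith.of_dist_le_mul fun x hx y hy => ?_
    rw [Real.coe_toNNReal _ (by positivity), dist_add_left, dist_eq_norm]
    have hx' : ε ≤ ‖x - z‖ := by simpa [dist_eq_norm] using hx
    have hy' : ε ≤ ‖y - z‖ := by simpa [dist_eq_norm] using hy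
    set a := x - z with ha
    set b := y - z with hb
    have hab : dist x y = ‖a - b‖ := by rw [dist_eq_norm, ha, hb]; congr 1; abel
    have hLab : |gauge D b - gauge D a| ≤ L * ‖a - b‖ := by
      have := hL.dist_le_mul b a
      rwa [Real.dist_eq, dist_eq_norm, norm_sub_rev b a] at this
    have hga := hg a
    have hgb := hg b
    have hga0 : 0 < gauge D a := by nlinarith
    have hgb0 : 0 < gauge D b := by nlinarith
    have hia : (gauge D a)⁻¹ ≤ M / ε := by
      rw [inv_le_comm₀ hga0 (by positivity), inv_div, div_le_iff₀ hM0]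
      nlinarith
    have key : (gauge D a)⁻¹ • a - (gauge D b)⁻¹ • b
        = (gauge D a)⁻¹ • (a - b)
          + ((gauge D a)⁻¹ * ((gauge D b - gauge D a) * (gauge D b)⁻¹)) • b := by
      have : (gauge D a)⁻¹ * ((gauge D b - gauge D a) * (gauge D b)⁻¹)
          = (gauge D a)⁻¹ - (gauge D b)⁻¹ := by field_simp
      rw [this]; module
    rw [key, hab]
    refine (norm_add_le _ _).trans ?_
    rw [norm_smul, norm_smul, Real.norm_eq_abs, Real.norm_eq_abs, abs_mul, abs_mul,
      abs_of_pos (inv_pos.2 hga0), abs_of_pos (inv_pos.2 hgb0)]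
    have h1 : (gauge D b)⁻¹ * ‖b‖ ≤ M := by
      rw [inv_mul_le_iff₀ hgb0]; linarith
    calc (gauge D a)⁻¹ * ‖a - b‖
          + (gauge D a)⁻¹ * (|gauge D b - gauge D a| * (gauge D b)⁻¹) * ‖b‖
        = (gauge D a)⁻¹ * (‖a - b‖ + |gauge D b - gauge D a| * ((gauge D b)⁻¹ * ‖b‖)) := by ring
      _ ≤ M / ε * (‖a - b‖ + L * ‖a - b‖ * M) := by gcongr
      _ = M / ε * (1 + M * L) * ‖a - b‖ := by ring
  obtain ⟨ρ, hρ, heq⟩ := hLip.extend_finite_dimension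
  refine ⟨ρ, ⟨_, hρ⟩, fun x hx => ?_⟩
  rw [← heq hx]
  have hx' : ε ≤ ‖x - z‖ := by simpa [dist_eq_norm] using hx
  have hg0 : 0 < gauge D (x - z) := by nlinarith [hg (x - z)]
  constructor
  · rw [hfr, ← gauge_eq_one_iff_mem_frontier hDc hD0, gauge_smul_of_nonneg (inv_pos.2 hg0).le,
      smul_eq_mul, inv_mul_cancel₀ hg0.ne']
  · intro hxf
    have : gauge D (x - z) = 1 := by
      rw [gauge_eq_one_iff_mem_frontier hDc hD0, ← hfr, add_sub_cancel]; exact hxf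
    simp [this]

/-! ### The cube and test pairs -/

theorem stdCube_eq_preimage (d : ℕ) :
    stdCube d = (EuclideanSpace.equiv (Fin d) ℝ) ⁻¹' (Set.pi univ fun _ => Icc (-1 : ℝ) 1) := by
  ext y
  exact ⟨fun h i _ => h i, fun h i => h i trivial⟩

theorem convex_stdCube (d : ℕ) : Convex ℝ (stdCube d) := by
  rw [stdCube_eq_preimage]
  exact (convex_pi fun _ _ => convex_Icc _ _).linear_preimage
    (EuclideanSpace.equiv (Fin d) ℝ).toLinearMap

theorem isCompact_stdCube (d : ℕ) : IsCompact (stdCube d) := by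
  rw [stdCube_eq_preimage]
  exact (EuclideanSpace.equiv (Fin d) ℝ).toHomeomorph.isCompact_preimage.2
    (isCompact_univ_pi fun _ => isCompact_Icc)

theorem interior_stdCube_nonempty (d : ℕ) : (interior (stdCube d)).Nonempty := by
  refine ⟨0, ?_⟩
  rw [stdCube_eq_preimage, mem_interior_iff_mem_nhds]
  refine (EuclideanSpace.equiv (Fin d) ℝ).continuous.continuousAt.preimage_mem_nhds ?_
  refine set_pi_mem_nhds finite_univ fun i _ => ?_
  exact Icc_mem_nhds (by simp) (by simp)

theorem IsCubicalTestPair.cube_subset_proj {n d : ℕ} {p : Eucl n →L[ℝ] Eucl d}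
    (hp : p ∘L p.adjoint = ContinuousLinearMap.id ℝ (Eucl d)) {S : Set (Eucl n)}
    (hS : IsCompact S) (hB : p.adjoint '' frontier (stdCube d) ⊆ S)
    (hret : ∀ f : Eucl n → Eucl n, (∃ K : ℝ≥0, LipschitzWith K f) →
      (∀ y ∈ p.adjoint '' frontier (stdCube d), f y = y) →
      f '' S ≠ p.adjoint '' frontier (stdCube d)) :
    stdCube d ⊆ p '' S := by
  intro z hz
  by_contra hzS
  have hcl : IsClosed (p '' S) := (hS.image p.continuous).isClosed
  -- The retraction needs an interior centre; the complement of the shadow is open, so the missed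
  -- point can be moved inside.
  have hzcl : z ∈ closure (interior (stdCube d)) := by
    rw [(convex_stdCube d).closure_interior_eq_closure_of_nonempty_interior
      (interior_stdCube_nonempty d)]
    exact subset_closure hz
  obtain ⟨w, hwS, hwi⟩ := mem_closure_iff.1 hzcl _ hcl.isOpen_compl hzS
  obtain ⟨ε, hε, hball⟩ := Metric.isOpen_iff.1 hcl.isOpen_compl w hwS
  obtain ⟨ρ, ⟨K, hK⟩, hρ⟩ := exists_lipschitz_retraction_frontier (convex_stdCube d)
    (isCompact_stdCube d).isBounded hwi hε
  have hout : ∀ y ∈ S, p y ∉ ball w ε := fun y hy h => hball h ⟨y, hy, rfl⟩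
  have hfix : ∀ y ∈ p.adjoint '' frontier (stdCube d), p.adjoint (ρ (p y)) = y := by
    rintro _ ⟨b, hb, rfl⟩
    have h1 := hout _ (hB ⟨b, hb, rfl⟩)
    rw [proj_adjoint hp] at h1 ⊢
    rw [(hρ b h1).2 hb]
  refine hret (fun y => p.adjoint (ρ (p y)))
    ⟨_, (isometry_adjoint hp).lipschitz.comp (hK.comp (lipschitzWith_proj hp))⟩ hfix ?_
  refine Subset.antisymm ?_ fun y hy => ⟨y, hB hy, hfix y hy⟩
  rintro _ ⟨y, hy, rfl⟩
  exact ⟨_, (hρ _ (hout y hy)).1, rfl⟩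

end AlmgrenElliptic

namespace AlmgrenElliptic

/-! ### Decomposition of rectifiable sets into Lipschitz graphs -/

/-- An invertible linear map stays injective with Lipschitz inverse under perturbations smaller than
the reciprocal norm of its inverse. The threshold is also defined for singular `A`, with dummy value
1, because the partition theorem wants a radius for every linear map. -/
theorem exists_antilipschitz_threshold {E : Type*} [NormedAddCommGroup E] [NormedSpace ℝ E]
    [FiniteDimensional ℝ E] (A : E →L[ℝ] E) :
    ∃ δ : ℝ≥0, δ ≠ 0 ∧ (A.det ≠ 0 → ∀ (f : E → E) (s : Set E), ApproximatesLinearOn f A s δ →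
      ∃ C : ℝ≥0, ∀ a ∈ s, ∀ b ∈ s, dist a b ≤ C * dist (f a) (f b)) := by
  by_cases hA : A.det = 0
  · exact ⟨1, one_ne_zero, fun h => absurd hA h⟩
  set B := A.toContinuousLinearEquivOfDetNeZero hA with hB
  have hBA : (B : E →L[ℝ] E) = A := A.coe_toContinuousLinearEquivOfDetNeZero hA
  have key : ∀ δ : ℝ≥0, (Subsingleton E ∨ δ < ‖(B.symm : E →L[ℝ] E)‖₊⁻¹) →
      ∀ (f : E → E) (s : Set E), ApproximatesLinearOn f A s δ →
      ∃ C : ℝ≥0, ∀ a ∈ s, ∀ b ∈ s, dist a b ≤ C * dist (f a) (f b) := by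
    intro δ hδ f s hf
    rw [← hBA] at hf
    exact ⟨_, fun a ha b hb => (hf.antilipschitz hδ).le_mul_dist ⟨a, ha⟩ ⟨b, hb⟩⟩
  rcases B.subsingleton_or_nnnorm_symm_pos with h | h
  · exact ⟨1, one_ne_zero, fun _ => key 1 (Or.inl h)⟩
  · have h' : 0 < ‖(B.symm : E →L[ℝ] E)‖₊⁻¹ := inv_pos.2 h
    exact ⟨‖(B.symm : E →L[ℝ] E)‖₊⁻¹ / 2, (half_pos h').ne',
      fun _ => key _ (Or.inr (NNReal.half_lt_self h'.ne'))⟩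

variable {n d : ℕ} {p : Eucl n →L[ℝ] Eucl d}

/-- A Lipschitz map whose shadow is bi-Lipschitz on `s` parametrizes a Lipschitz graph. -/
theorem exists_graph_of_antilipschitz (hp : p ∘L p.adjoint = ContinuousLinearMap.id ℝ (Eucl d))
    {f : Eucl d → Eucl n} {K : ℝ≥0} (hf : LipschitzWith K f) {s : Set (Eucl d)} {C : ℝ≥0}
    (hs : ∀ a ∈ s, ∀ b ∈ s, dist a b ≤ C * dist (p (f a)) (p (f b))) :
    ∃ u : Eucl d → Eucl n, (∃ K : ℝ≥0, LipschitzWith K u) ∧ (∀ z, p (u z) = 0) ∧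
      ∀ a ∈ s, p.adjoint (p (f a)) + u (p (f a)) = f a := by
  set g := Function.invFunOn (fun a => p (f a)) s with hg
  have hinj : InjOn (fun a => p (f a)) s := fun a ha b hb hab => by
    have := hs a ha b hb
    simp only at hab
    rw [hab, dist_self, mul_zero] at this
    exact dist_le_zero.1 this
  have hgf : ∀ a ∈ s, g (p (f a)) = a := fun a ha => hinj.leftInvOn_invFunOn ha
  have hlip : LipschitzOnWith (K * C) (fun z => f (g z)) ((fun a => p (f a)) '' s) := by
    refine LipschitzOnWith.of_dist_le_mul ?_
    rintro _ ⟨a, ha, rfl⟩ _ ⟨b, hb, rfl⟩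
    simp only [hgf a ha, hgf b hb]
    calc dist (f a) (f b) ≤ K * dist a b := hf.dist_le_mul a b
      _ ≤ K * (C * dist (p (f a)) (p (f b))) := by gcongr; exact hs a ha b hb
      _ = ((K * C : ℝ≥0) : ℝ) * dist (p (f a)) (p (f b)) := by push_cast; ring
  obtain ⟨v, hv, hveq⟩ := hlip.extend_finite_dimension
  -- Removing the horizontal part makes `u` vertical everywhere, including where `v` is only an
  -- arbitrary extension.
  refine ⟨fun z => v z - p.adjoint (p (v z)),
    ⟨_, hv.sub ((isometry_adjoint hp).lipschitz.comp ((lipschitzWith_proj hp).comp hv))⟩,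
    fun z => by rw [map_sub, proj_adjoint hp, sub_self], fun a ha => ?_⟩
  have h1 : v (p (f a)) = f a := by
    rw [← hveq ⟨a, ha, rfl⟩]
    simp only [hgf a ha]
  simp only [h1, add_sub_cancel]

/-- Where `p ∘ f` has invertible derivative it is antilipschitz on countably many pieces, so `f`
parametrizes graphs there. The nondifferentiable and critical points have null shadow, by Rademacher
and Sard. Vertical parts may still carry area, hence a conclusion about shadows only. -/
theorem exists_graph_cover_of_lipschitz (hp : p ∘L p.adjoint = ContinuousLinearMap.id ℝ (Eucl d))
    {f : Eucl d → Eucl n} {K : ℝ≥0} (hf : LipschitzWith K f) {R : Set (Eucl n)}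
    (hR : MeasurableSet R) :
    ∃ (W : ℕ → Set (Eucl d)) (u : ℕ → Eucl d → Eucl n), (∀ j, MeasurableSet (W j)) ∧
      (∀ j, ∃ K : ℝ≥0, LipschitzWith K (u j)) ∧ (∀ j z, p (u j z) = 0) ∧
      (∀ j, ∀ z ∈ W j, p.adjoint z + u j z ∈ R) ∧
      volume (p '' ((R ∩ range f) \ ⋃ j, (fun z => p.adjoint z + u j z) '' W j)) = 0 := by
  set h : Eucl d → Eucl d := fun a => p (f a) with hh
  have hlip : LipschitzWith (1 * K) h := (lipschitzWith_proj hp).comp hf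
  set D : Set (Eucl d) :=
    f ⁻¹' R ∩ {a | DifferentiableAt ℝ h a} ∩ {a | (fderiv ℝ h a).det ≠ 0} with hD
  have hDm : MeasurableSet D := by
    refine ((hf.continuous.measurable hR).inter (measurableSet_of_differentiableAt ℝ h)).inter ?_
    exact (ContinuousLinearMap.continuous_det.measurable.comp (measurable_fderiv ℝ h))
      (measurableSet_singleton 0).compl
  choose r hr0 hr using fun A : Eucl d →L[ℝ] Eucl d => exists_antilipschitz_threshold A
  obtain ⟨t, A, -, htm, htD, hA, hAD⟩ :=
    exists_partition_approximatesLinearOn_of_hasFDerivWithinAt h D (fderiv ℝ h)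
      (fun a ha => ha.1.2.hasFDerivAt.hasFDerivWithinAt) r hr0
  have hanti : ∀ j, ∃ C : ℝ≥0, ∀ a ∈ D ∩ t j, ∀ b ∈ D ∩ t j, dist a b ≤ C * dist (h a) (h b) := by
    intro j
    rcases D.eq_empty_or_nonempty with hDe | hDn
    · exact ⟨0, fun a ha => by simp [hDe] at ha⟩
    · obtain ⟨y, hy, hyA⟩ := hAD hDn j
      exact hr (A j) (by rw [hyA]; exact hy.2) h _ (hA j)
  choose C hC using hanti
  choose u hul hup hu using fun j => exists_graph_of_antilipschitz hp hf (hC j)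
  refine ⟨fun j => h '' (D ∩ t j), u, fun j => ?_, hul, hup, ?_, ?_⟩
  -- Lusin–Souslin: a continuous injective image of a Borel set is Borel.
  · refine (hDm.inter (htm j)).image_of_continuousOn_injOn hlip.continuous.continuousOn ?_
    intro a ha b hb hab
    have := hC j a ha b hb
    rw [hab, dist_self, mul_zero] at this
    exact dist_le_zero.1 this
  · rintro j _ ⟨a, ha, rfl⟩
    simp only [hh]
    rw [hu j a ha]
    exact ha.1.1.1
  · have h1 : volume (h '' {a | ¬ DifferentiableAt ℝ h a}) = 0 := by
      have h0 : volume {a | ¬ DifferentiableAt ℝ h a} = 0 := hlip.ae_differentiableAt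
      have := volume_image_le hlip {a | ¬ DifferentiableAt ℝ h a}
      rw [EuclideanSpace.euclideanHausdorffMeasure_eq_volume, h0, mul_zero] at this
      exact le_antisymm this bot_le
    have h2 : volume (h '' {a | DifferentiableAt ℝ h a ∧ (fderiv ℝ h a).det = 0}) = 0 :=
      addHaar_image_eq_zero_of_det_fderivWithin_eq_zero volume
        (fun a ha => ha.1.hasFDerivAt.hasFDerivWithinAt) fun a ha => ha.2
    refine measure_mono_null ?_ (measure_union_null h1 h2)
    rintro _ ⟨_, ⟨⟨hyR, a, rfl⟩, hy⟩, rfl⟩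
    by_cases hd : DifferentiableAt ℝ h a
    · by_cases hdet : (fderiv ℝ h a).det = 0
      · exact Or.inr ⟨a, ⟨hd, hdet⟩, rfl⟩
      · refine absurd ?_ hy
        have haD : a ∈ D := ⟨⟨hyR, hd⟩, hdet⟩
        obtain ⟨j, hj⟩ := mem_iUnion.1 (htD haD)
        exact mem_iUnion.2 ⟨j, _, ⟨a, ⟨haD, hj⟩, rfl⟩, hu j a ⟨haD, hj⟩⟩
    · exact Or.inl ⟨a, hd, rfl⟩

theorem IsRectifiable.exists_graph_cover
    (hp : p ∘L p.adjoint = ContinuousLinearMap.id ℝ (Eucl d)) {R : Set (Eucl n)}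
    (hR : MeasurableSet R) (hrect : IsRectifiable d R) :
    ∃ (W : ℕ × ℕ → Set (Eucl d)) (u : ℕ × ℕ → Eucl d → Eucl n), (∀ j, MeasurableSet (W j)) ∧
      (∀ j, ∃ K : ℝ≥0, LipschitzWith K (u j)) ∧ (∀ j z, p (u j z) = 0) ∧
      (∀ j, ∀ z ∈ W j, p.adjoint z + u j z ∈ R) ∧
      volume (p '' (R \ ⋃ j, (fun z => p.adjoint z + u j z) '' W j)) = 0 := by
  obtain ⟨-, f, hf, hcov⟩ := hrect
  choose K hK using hf
  choose W u hW hu hpu hWR hnull using fun i => exists_graph_cover_of_lipschitz hp (hK i) hR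
  refine ⟨fun j => W j.1 j.2, fun j => u j.1 j.2, fun j => hW _ _, fun j => hu _ _,
    fun j => hpu _ _, fun j => hWR _ _, ?_⟩
  have h1 : volume (p '' (R \ ⋃ i, range (f i))) = 0 :=
    le_antisymm ((volume_proj_image_le hp _).trans hcov.le) bot_le
  refine measure_mono_null ?_ (measure_union_null h1 (measure_iUnion_null hnull))
  rintro _ ⟨y, ⟨hyR, hy⟩, rfl⟩
  by_cases hyf : y ∈ ⋃ i, range (f i)
  · obtain ⟨i, hi⟩ := mem_iUnion.1 hyf
    refine Or.inr (mem_iUnion.2 ⟨i, y, ⟨⟨hyR, hi⟩, fun hc => hy ?_⟩, rfl⟩)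
    obtain ⟨j, hj⟩ := mem_iUnion.1 hc
    exact mem_iUnion.2 ⟨(i, j), hj⟩
  · exact Or.inl ⟨y, ⟨hyR, hyf⟩, rfl⟩

end AlmgrenElliptic

namespace AlmgrenElliptic

/-! ### Graphs without excess area are horizontal -/

theorem one_add_pow_le_one_add_three_pow_mul (d : ℕ) {x : ℝ} (h0 : 0 ≤ x) (h1 : x ≤ 1) :
    (1 + x) ^ d ≤ 1 + 3 ^ d * x := by
  induction d with
  | zero => simp [h0]
  | succ d ih =>
    have h3 : (1 : ℝ) ≤ 3 ^ d := one_le_pow₀ (by norm_num)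
    calc (1 + x) ^ (d + 1) = (1 + x) ^ d * (1 + x) := pow_succ _ _
      _ ≤ (1 + 3 ^ d * x) * (1 + x) := by gcongr
      _ = 1 + x * (3 ^ d + 1 + 3 ^ d * x) := by ring
      _ ≤ 1 + x * (3 ^ d + 3 ^ d + 3 ^ d * 1) := by gcongr
      _ = 1 + 3 ^ (d + 1) * x := by ring

/-- With `t = 1 / (k + 1)`, the two signs give `t * |s| ≤ 3 ^ d * t ^ 2`; divide by `t` and let `k →
∞`. -/
theorem eq_zero_of_abs_one_add_mul_le {d k₀ : ℕ} {s : ℝ}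
    (h : ∀ k : ℕ, k₀ ≤ k → |1 + (1 / ((k : ℝ) + 1)) * s| ≤ (1 + (1 / ((k : ℝ) + 1)) ^ 2) ^ d ∧
      |1 + (-(1 / ((k : ℝ) + 1))) * s| ≤ (1 + (-(1 / ((k : ℝ) + 1))) ^ 2) ^ d) : s = 0 := by
  have hlim : Tendsto (fun k : ℕ => (3 : ℝ) ^ d * (1 / ((k : ℝ) + 1))) atTop (𝓝 0) := by
    simpa using tendsto_one_div_add_atTop_nhds_zero_nat.const_mul ((3 : ℝ) ^ d)
  refine abs_nonpos_iff.1 (ge_of_tendsto hlim ?_)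
  filter_upwards [eventually_ge_atTop k₀] with k hk
  obtain ⟨h1, h2⟩ := h k hk
  have ht0 : 0 < 1 / ((k : ℝ) + 1) := Nat.one_div_pos_of_nat
  have ht1 : 1 / ((k : ℝ) + 1) ≤ 1 := by
    rw [div_le_one (by positivity)]; linarith [(Nat.cast_nonneg k : (0 : ℝ) ≤ k)]
  set t := 1 / ((k : ℝ) + 1)
  rw [neg_sq] at h2
  have hpow := one_add_pow_le_one_add_three_pow_mul d (sq_nonneg t) (by nlinarith)
  have h1' := (le_abs_self _).trans (h1.trans hpow)
  have h2' := (le_abs_self _).trans (h2.trans hpow)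
  refine abs_le.2 ⟨?_, ?_⟩
  · refine le_of_mul_le_mul_left ?_ ht0
    linarith
  · refine le_of_mul_le_mul_left ?_ ht0
    linarith

variable {n d : ℕ} {p : Eucl n →L[ℝ] Eucl d}

/-- Cauchy–Schwarz on the orthogonal splitting gives the constant `√(1 + t ^ 2)`. The cruder `1 + t
^ 2` suffices: what matters is that no term of first order in `t` appears. -/
theorem lipschitzWith_tilted_proj (hp : p ∘L p.adjoint = ContinuousLinearMap.id ℝ (Eucl d))
    {v : Eucl d} {w : Eucl n} (hv : ‖v‖ = 1) (hw : ‖w‖ = 1) (t : ℝ) :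
    LipschitzWith (Real.toNNReal (1 + t ^ 2))
      (fun x : Eucl n => p x + (t * inner ℝ w (x - p.adjoint (p x))) • v) := by
  have hb : ∀ x : Eucl n, ‖p x + (t * inner ℝ w (x - p.adjoint (p x))) • v‖
      ≤ (1 + t ^ 2) * ‖x‖ := by
    intro x
    have h1 : ‖(t * inner ℝ w (x - p.adjoint (p x))) • v‖ ≤ |t| * ‖x - p.adjoint (p x)‖ := by
      rw [norm_smul, hv, mul_one, Real.norm_eq_abs, abs_mul]
      gcongr
      simpa [hw] using abs_real_inner_le_norm w (x - p.adjoint (p x))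
    have h2 := (norm_add_le (p x) ((t * inner ℝ w (x - p.adjoint (p x))) • v)).trans
      (add_le_add_right h1 _)
    refine h2.trans (abs_le_of_sq_le_sq' ?_ (by positivity)).2
    have h3 := norm_sq_eq_proj hp x
    set a := ‖p x‖
    set b := ‖x - p.adjoint (p x)‖
    have ht := sq_abs t
    have : (a + |t| * b) ^ 2 ≤ (1 + t ^ 2) * ‖x‖ ^ 2 := by
      rw [h3]; nlinarith [sq_nonneg (|t| * a - b)]
    nlinarith [mul_nonneg (mul_nonneg (sq_nonneg t) (sq_nonneg ‖x‖)) (by positivity : 0 ≤ 1 + t ^ 2)]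
  refine LipschitzWith.of_dist_le_mul fun x y => ?_
  rw [Real.coe_toNNReal _ (by positivity), dist_eq_norm, dist_eq_norm]
  refine le_of_eq_of_le (congrArg norm ?_) (hb (x - y))
  simp only [map_sub, inner_sub_right]
  module

/-- On the graph the tilted projection reads `ψ = id + t⟨w, u⟩v`, whose derivative is a transvection
with determinant `1 + t⟨w, Du v⟩`. The Lipschitz bound limits the volume of each `ψ '' s`, and the
area formula localizes this. The condition `|t| * K < 1` makes `ψ` injective. -/
theorem ae_abs_one_add_fderiv_le (hp : p ∘L p.adjoint = ContinuousLinearMap.id ℝ (Eucl d))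
    {W : Set (Eucl d)} (hWm : MeasurableSet W) {u : Eucl d → Eucl n} {K : ℝ≥0}
    (hu : LipschitzWith K u) (hpu : ∀ z, p (u z) = 0)
    (hW : ∀ s ⊆ W, MeasurableSet s → μHE[d] ((fun z => p.adjoint z + u z) '' s) ≤ volume s)
    {v : Eucl d} {w : Eucl n} (hv : ‖v‖ = 1) (hw : ‖w‖ = 1) {t : ℝ} (ht : |t| * K < 1) :
    ∀ᵐ z ∂volume.restrict W, |1 + t * inner ℝ w (fderiv ℝ u z v)| ≤ (1 + t ^ 2) ^ d := by
  set ψ : Eucl d → Eucl d := fun z => z + (t * inner ℝ w (u z)) • v with hψ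
  set D : Set (Eucl d) := {z | DifferentiableAt ℝ u z} with hD
  have hDm : MeasurableSet D := measurableSet_of_differentiableAt ℝ u
  have hDae : ∀ᵐ z : Eucl d, z ∈ D := hu.ae_differentiableAt
  have hinj : Function.Injective ψ := by
    intro a b hab
    have h1 : a - b = (t * inner ℝ w (u b - u a)) • v := by
      have : a + (t * inner ℝ w (u a)) • v = b + (t * inner ℝ w (u b)) • v := hab
      rw [inner_sub_right, mul_sub, sub_smul, sub_eq_sub_iff_add_eq_add, this, add_comm]
    have h2 : ‖a - b‖ ≤ |t| * (K * ‖a - b‖) := by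
      have h3 : ‖u b - u a‖ ≤ K * ‖a - b‖ := by
        have := hu.dist_le_mul b a
        rwa [dist_eq_norm, dist_eq_norm, norm_sub_rev b a] at this
      calc ‖a - b‖ = |t| * |inner ℝ w (u b - u a)| := by
            conv_lhs => rw [h1]
            rw [norm_smul, hv, mul_one, Real.norm_eq_abs, abs_mul]
        _ ≤ |t| * (‖w‖ * ‖u b - u a‖) := by gcongr; exact abs_real_inner_le_norm _ _
        _ ≤ |t| * (K * ‖a - b‖) := by rw [hw, one_mul]; gcongr
    by_contra hne
    have : 0 < ‖a - b‖ := norm_pos_iff.2 (sub_ne_zero.2 hne)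
    nlinarith
  set ψ' : Eucl d → Eucl d →L[ℝ] Eucl d := fun z => ContinuousLinearMap.id ℝ (Eucl d) +
    (t • (innerSL ℝ w ∘L fderiv ℝ u z)).smulRight v with hψ'
  have hderiv : ∀ z ∈ D, HasFDerivAt ψ (ψ' z) z := by
    intro z hz
    have h1 : HasFDerivAt (fun y => inner ℝ w (u y)) (innerSL ℝ w ∘L fderiv ℝ u z) z :=
      (innerSL ℝ w).hasFDerivAt.comp z (DifferentiableAt.hasFDerivAt hz)
    exact (hasFDerivAt_id z).add ((h1.const_mul t).smul_const v)
  have hdet : ∀ z, (ψ' z).det = 1 + t * inner ℝ w (fderiv ℝ u z v) := by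
    intro z
    have : ((ψ' z : Eucl d →L[ℝ] Eucl d) : Eucl d →ₗ[ℝ] Eucl d) = LinearMap.transvection
        ((t • (innerSL ℝ w ∘L fderiv ℝ u z) : Eucl d →L[ℝ] ℝ) : Eucl d →ₗ[ℝ] ℝ) v := by
      ext y
      simp [ψ', LinearMap.transvection]
    rw [ContinuousLinearMap.det, this, LinearMap.transvection.det]
    simp
  have himg : ∀ s ⊆ W, MeasurableSet s →
      volume (ψ '' s) ≤ ENNReal.ofReal ((1 + t ^ 2) ^ d) * volume s := by
    intro s hs hsm
    have h1 : ψ '' s = (fun x : Eucl n => p x + (t * inner ℝ w (x - p.adjoint (p x))) • v) ''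
        ((fun z => p.adjoint z + u z) '' s) := by
      rw [image_image]
      refine image_congr fun z _ => ?_
      simp only [map_add, proj_adjoint hp, hpu, add_zero, add_sub_cancel_left, hψ]
    rw [h1]
    refine (volume_image_le (lipschitzWith_tilted_proj hp hv hw t) _).trans ?_
    rw [ENNReal.ofReal_pow (by positivity)]
    gcongr
    · exact le_rfl
    · exact hW s hs hsm
  have hfm : Measurable fun z => ENNReal.ofReal |1 + t * inner ℝ w (fderiv ℝ u z v)| := by
    have : Measurable fun z => fderiv ℝ u z v := measurable_fderiv_apply_const ℝ u v
    have h2 : Measurable fun z => inner ℝ w (fderiv ℝ u z v) :=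
      (innerSL ℝ w).continuous.measurable.comp this
    exact ((measurable_const.add (h2.const_mul t)).abs).ennreal_ofReal
  have hle : (fun z => ENNReal.ofReal |1 + t * inner ℝ w (fderiv ℝ u z v)|)
      ≤ᵐ[volume.restrict W] fun _ => ENNReal.ofReal ((1 + t ^ 2) ^ d) := by
    refine ae_le_of_forall_setLIntegral_le_of_sigmaFinite hfm fun s hs _ => ?_
    rw [Measure.restrict_restrict hs, setLIntegral_const]
    have hae : (s ∩ W ∩ D : Set (Eucl d)) =ᵐ[volume] (s ∩ W : Set (Eucl d)) := by
      filter_upwards [hDae] with z hz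
      exact propext ⟨fun h => h.1, fun h => ⟨h, hz⟩⟩
    have hm : MeasurableSet (s ∩ W ∩ D) := (hs.inter hWm).inter hDm
    rw [← Measure.restrict_congr_set hae, ← measure_congr hae]
    refine le_trans (le_of_eq ?_) (himg _ (fun z hz => hz.1.2) hm)
    rw [← lintegral_abs_det_fderiv_eq_addHaar_image volume hm
      (fun z hz => (hderiv z hz.2).hasFDerivWithinAt) hinj.injOn]
    simp only [hdet]
  filter_upwards [hle] with z hz
  exact (ENNReal.ofReal_le_ofReal_iff (by positivity)).1 hz

theorem ae_hasFDerivAt_zero (hp : p ∘L p.adjoint = ContinuousLinearMap.id ℝ (Eucl d))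
    {W : Set (Eucl d)} (hWm : MeasurableSet W) {u : Eucl d → Eucl n} {K : ℝ≥0}
    (hu : LipschitzWith K u) (hpu : ∀ z, p (u z) = 0)
    (hW : ∀ s ⊆ W, MeasurableSet s → μHE[d] ((fun z => p.adjoint z + u z) '' s) ≤ volume s) :
    ∀ᵐ z ∂volume.restrict W, HasFDerivAt u (0 : Eucl d →L[ℝ] Eucl n) z := by
  obtain ⟨k₀, hk₀⟩ := exists_nat_gt (K : ℝ)
  have hlt : ∀ k : ℕ, k₀ ≤ k → |1 / ((k : ℝ) + 1)| * K < 1 := by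
    intro k hk
    rw [abs_of_pos Nat.one_div_pos_of_nat, one_div, inv_mul_lt_iff₀ (by positivity)]
    have : (k₀ : ℝ) ≤ k := by exact_mod_cast hk
    linarith
  have hbv : ∀ i : Fin d, ‖(EuclideanSpace.single i (1 : ℝ) : Eucl d)‖ = 1 := by simp
  have hbw : ∀ i : Fin n, ‖(EuclideanSpace.single i (1 : ℝ) : Eucl n)‖ = 1 := by simp
  -- Countably many `t` keep the exceptional set null; `k ≥ k₀ > K` ensures `|t| * K < 1`.
  have hall : ∀ᵐ z ∂volume.restrict W, ∀ (i : Fin d) (j : Fin n) (k : ℕ), k₀ ≤ k →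
      |1 + (1 / ((k : ℝ) + 1)) * inner ℝ (EuclideanSpace.single j (1 : ℝ))
        (fderiv ℝ u z (EuclideanSpace.single i (1 : ℝ)))| ≤ (1 + (1 / ((k : ℝ) + 1)) ^ 2) ^ d ∧
      |1 + (-(1 / ((k : ℝ) + 1))) * inner ℝ (EuclideanSpace.single j (1 : ℝ))
        (fderiv ℝ u z (EuclideanSpace.single i (1 : ℝ)))| ≤
          (1 + (-(1 / ((k : ℝ) + 1))) ^ 2) ^ d := by
    simp only [ae_all_iff]
    intro i j k hk
    refine (ae_abs_one_add_fderiv_le hp hWm hu hpu hW (hbv i) (hbw j) (hlt k hk)).and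
      (ae_abs_one_add_fderiv_le hp hWm hu hpu hW (hbv i) (hbw j) ?_)
    rw [abs_neg]
    exact hlt k hk
  have hdiff : ∀ᵐ z ∂volume.restrict W, DifferentiableAt ℝ u z :=
    ae_restrict_of_ae hu.ae_differentiableAt
  filter_upwards [hall, hdiff] with z hz hzd
  have h0 : fderiv ℝ u z = 0 := by
    have : (fderiv ℝ u z : Eucl d →ₗ[ℝ] Eucl n) = 0 := by
      refine (EuclideanSpace.basisFun (Fin d) ℝ).toBasis.ext fun i => ?_
      ext j
      have := eq_zero_of_abs_one_add_mul_le (hz i j)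
      simpa [EuclideanSpace.inner_single_left] using this
    exact ContinuousLinearMap.coe_injective this
  rw [← h0]
  exact hzd.hasFDerivAt

end AlmgrenElliptic

namespace AlmgrenElliptic

/-! ### Measures that are asymptotically horizontal at a point -/

/-- The volume `α(d)` of the unit ball of `ℝᵈ`. -/
noncomputable def unitBallVol (d : ℕ) : ℝ := (volume : Measure (Eucl d)).real (closedBall 0 1)

theorem unitBallVol_pos (d : ℕ) : 0 < unitBallVol d :=
  ENNReal.toReal_pos (measure_closedBall_pos _ _ one_pos).ne' measure_closedBall_lt_top.ne

theorem measureReal_closedBall_eq {d : ℕ} (z : Eucl d) {r : ℝ} (hr : 0 ≤ r) :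
    (volume : Measure (Eucl d)).real (closedBall z r) = unitBallVol d * r ^ d := by
  rw [addHaar_real_closedBall' _ _ hr, finrank_euclideanSpace_fin, mul_comm, unitBallVol]

theorem hasDensity_iff {n : ℕ} (d : ℕ) (ν : Measure (Eucl n)) [IsFiniteMeasure ν] (a : Eucl n)
    {θ : ℝ} (hθ : 0 ≤ θ) : HasDensity d ν a (ENNReal.ofReal θ) ↔
      Tendsto (fun r : ℝ => ν.real (closedBall a r) / (unitBallVol d * r ^ d)) (𝓝[>] 0) (𝓝 θ) := by
  have hpos := unitBallVol_pos d
  have key : (fun r : ℝ => ν (closedBall a r) /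
      ((volume : Measure (Eucl d)) (closedBall 0 1) * ENNReal.ofReal (r ^ d)))
      =ᶠ[𝓝[>] 0]
      fun r => ENNReal.ofReal (ν.real (closedBall a r) / (unitBallVol d * r ^ d)) := by
    filter_upwards [self_mem_nhdsWithin] with r hr
    have hr' : (0 : ℝ) < r := hr
    rw [ENNReal.ofReal_div_of_pos (by positivity), ENNReal.ofReal_mul hpos.le,
      ofReal_measureReal, unitBallVol, ofReal_measureReal measure_closedBall_lt_top.ne]
  rw [HasDensity, tendsto_congr' key]
  constructor
  · intro h
    have h2 := (ENNReal.tendsto_toReal ENNReal.ofReal_ne_top).comp h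
    rw [ENNReal.toReal_ofReal hθ] at h2
    refine h2.congr' ?_
    filter_upwards [self_mem_nhdsWithin] with r hr
    have hr' : (0 : ℝ) < r := hr
    exact ENNReal.toReal_ofReal (by positivity)
  · exact fun h => (ENNReal.continuous_ofReal.tendsto θ).comp h

variable {n d : ℕ}

/-- The closed cone of slope `ε` around the affine plane `y + im p*`. -/
def horizCone (p : Eucl n →L[ℝ] Eucl d) (ε : ℝ) (y : Eucl n) : Set (Eucl n) :=
  {x | ‖(x - y) - p.adjoint (p (x - y))‖ ≤ ε * ‖p (x - y)‖}

/-- Asymptotically at `y`, the measure `ν` has full `d`-dimensional density, over the balls around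
`p y`, inside every horizontal cone at `y`. -/
def IsHorizAt (p : Eucl n →L[ℝ] Eucl d) (ν : Measure (Eucl n)) (y : Eucl n) : Prop :=
  ∀ ε > 0, ∀ η > 0, ∀ᶠ r in 𝓝[>] (0 : ℝ), (1 - η) * (unitBallVol d * r ^ d) ≤
    ν.real (p ⁻¹' closedBall (p y) r ∩ horizCone p ε y)

theorem isClosed_horizCone (p : Eucl n →L[ℝ] Eucl d) (ε : ℝ) (y : Eucl n) :
    IsClosed (horizCone p ε y) := by
  refine isClosed_le ?_ ?_ <;> fun_prop

theorem tendsto_mul_nhdsGT_zero {c : ℝ} (hc : 0 < c) :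
    Tendsto (fun r : ℝ => c * r) (𝓝[>] 0) (𝓝[>] 0) := by
  refine tendsto_nhdsWithin_iff.2 ⟨?_, ?_⟩
  · have : Tendsto (fun r : ℝ => c * r) (𝓝 0) (𝓝 (c * 0)) := tendsto_id.const_mul c
    rw [mul_zero] at this
    exact this.mono_left nhdsWithin_le_nhds
  · filter_upwards [self_mem_nhdsWithin] with r hr
    exact mul_pos hc hr

section

variable {p : Eucl n →L[ℝ] Eucl d} {ν : Measure (Eucl n)} {y : Eucl n}

theorem dist_le_of_mem_horizCone (hp : p ∘L p.adjoint = ContinuousLinearMap.id ℝ (Eucl d))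
    {ε : ℝ} {x : Eucl n} (hx : x ∈ horizCone p ε y) : dist x y ≤ (1 + ε) * dist (p x) (p y) := by
  have h : ‖(x - y) - p.adjoint (p (x - y))‖ ≤ ε * ‖p (x - y)‖ := hx
  have h2 := norm_add_le ((x - y) - p.adjoint (p (x - y))) (p.adjoint (p (x - y)))
  rw [sub_add_cancel, norm_adjoint hp] at h2
  rw [dist_eq_norm, dist_eq_norm, ← map_sub]
  linarith

theorem measureReal_preimage_le (hν : ∀ E : Set (Eucl d), MeasurableSet E → ν (p ⁻¹' E) ≤ volume E)
    {E : Set (Eucl d)} (hE : MeasurableSet E) (hE' : volume E ≠ ∞) :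
    ν.real (p ⁻¹' E) ≤ (volume : Measure (Eucl d)).real E :=
  ENNReal.toReal_mono hE' (hν E hE)

theorem measureReal_preimage_closedBall_le
    (hν : ∀ E : Set (Eucl d), MeasurableSet E → ν (p ⁻¹' E) ≤ volume E) (z : Eucl d) {r : ℝ}
    (hr : 0 ≤ r) : ν.real (p ⁻¹' closedBall z r) ≤ unitBallVol d * r ^ d := by
  rw [← measureReal_closedBall_eq z hr]
  exact measureReal_preimage_le hν measurableSet_closedBall measure_closedBall_lt_top.ne

theorem closedBall_subset_preimage (hp : p ∘L p.adjoint = ContinuousLinearMap.id ℝ (Eucl d))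
    (y : Eucl n) (r : ℝ) : closedBall y r ⊆ p ⁻¹' closedBall (p y) r := fun x hx =>
  ((lipschitzWith_proj hp).dist_le_mul x y).trans (by simpa using hx)

variable [IsFiniteMeasure ν]

theorem IsHorizAt.hasDensity_one (hp : p ∘L p.adjoint = ContinuousLinearMap.id ℝ (Eucl d))
    (hν : ∀ E : Set (Eucl d), MeasurableSet E → ν (p ⁻¹' E) ≤ volume E)
    (hy : IsHorizAt p ν y) : HasDensity d ν y 1 := by
  have hpos := unitBallVol_pos d
  rw [← ENNReal.ofReal_one, hasDensity_iff d ν y zero_le_one]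
  refine tendsto_order.2 ⟨fun a ha => ?_, fun a ha => ?_⟩
  -- Cone points over the ball of radius `r / (1 + ε)` lie within `r` of `y`; taking `η = ε` bounds
  -- the density ratio below by this function.
  · have hcont : Tendsto (fun ε : ℝ => (1 - ε) * ((1 + ε)⁻¹) ^ d) (𝓝[>] 0) (𝓝 1) := by
      have : ContinuousAt (fun ε : ℝ => (1 - ε) * ((1 + ε)⁻¹) ^ d) 0 := by
        fun_prop (disch := norm_num)
      simpa [ContinuousAt] using this.tendsto.mono_left nhdsWithin_le_nhds
    obtain ⟨ε, hεa, hε⟩ := ((hcont.eventually (lt_mem_nhds ha)).and self_mem_nhdsWithin).exists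
    have hε' : (0 : ℝ) < ε := hε
    have hc : 0 < (1 + ε)⁻¹ := by positivity
    filter_upwards [(tendsto_mul_nhdsGT_zero hc).eventually (hy ε hε' ε hε'),
      self_mem_nhdsWithin] with r hr hr0
    have hr0' : (0 : ℝ) < r := hr0
    rw [lt_div_iff₀ (by positivity)]
    refine lt_of_lt_of_le ?_ (hr.trans (measureReal_mono ?_))
    · rw [mul_pow]
      have := mul_lt_mul_of_pos_right hεa (by positivity : 0 < unitBallVol d * r ^ d)
      linarith
    · rintro x ⟨hx1, hx2⟩
      have h1 : dist (p x) (p y) ≤ (1 + ε)⁻¹ * r := hx1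
      refine mem_closedBall.2 ((dist_le_of_mem_horizCone hp hx2).trans ?_)
      calc (1 + ε) * dist (p x) (p y) ≤ (1 + ε) * ((1 + ε)⁻¹ * r) := by gcongr
        _ = r := by field_simp
  · filter_upwards [self_mem_nhdsWithin] with r hr
    have hr' : (0 : ℝ) < r := hr
    refine lt_of_le_of_lt ?_ ha
    rw [div_le_one (by positivity)]
    exact (measureReal_mono (closedBall_subset_preimage hp y r)).trans
      (measureReal_preimage_closedBall_le hν _ hr'.le)

/-- The cylinder over a ball has at most the mass of the ball, and the cone already takes almost all
of it. -/
theorem IsHorizAt.hasDensity_compl_horizCone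
    (hp : p ∘L p.adjoint = ContinuousLinearMap.id ℝ (Eucl d))
    (hν : ∀ E : Set (Eucl d), MeasurableSet E → ν (p ⁻¹' E) ≤ volume E)
    (hy : IsHorizAt p ν y) {ε : ℝ} (hε : 0 < ε) :
    HasDensity d (ν.restrict (horizCone p ε y)ᶜ) y 0 := by
  have hpos := unitBallVol_pos d
  rw [← ENNReal.ofReal_zero, hasDensity_iff d _ y le_rfl]
  refine tendsto_order.2 ⟨fun a ha => ?_, fun a ha => ?_⟩
  · filter_upwards [self_mem_nhdsWithin] with r hr
    have hr' : (0 : ℝ) < r := hr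
    exact lt_of_lt_of_le ha (by positivity)
  · filter_upwards [hy ε hε (a / 2) (half_pos ha), self_mem_nhdsWithin] with r hr hr0
    have hr0' : (0 : ℝ) < r := hr0
    have hb : 0 < unitBallVol d * r ^ d := by positivity
    rw [div_lt_iff₀ hb, measureReal_restrict_apply measurableSet_closedBall, ← sdiff_eq]
    have h1 : ν.real (closedBall y r \ horizCone p ε y) ≤
        ν.real (p ⁻¹' closedBall (p y) r \ horizCone p ε y) :=
      measureReal_mono (sdiff_subset_sdiff_left (closedBall_subset_preimage hp y r))
    have h2 := measureReal_inter_add_sdiff (μ := ν) (s := p ⁻¹' closedBall (p y) r)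
      (isClosed_horizCone p ε y).measurableSet
    have h3 := measureReal_preimage_closedBall_le hν (p y) hr0'.le
    nlinarith

theorem posTangentConeAt_horizCone_subset (p : Eucl n →L[ℝ] Eucl d) (ε : ℝ) (y : Eucl n) :
    posTangentConeAt (horizCone p ε y) y ⊆ {v | ‖v - p.adjoint (p v)‖ ≤ ε * ‖p v‖} := by
  intro v hv
  obtain ⟨α, l, hl, c, w, -, hw, hcw⟩ := exists_fun_of_mem_tangentConeAt hv
  have hcl : IsClosed {v : Eucl n | ‖v - p.adjoint (p v)‖ ≤ ε * ‖p v‖} := by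
    refine isClosed_le ?_ ?_ <;> fun_prop
  refine hcl.mem_of_tendsto hcw ?_
  filter_upwards [hw] with i hi
  have h : ‖w i - p.adjoint (p (w i))‖ ≤ ε * ‖p (w i)‖ := by
    simpa [horizCone] using hi
  simp only [NNReal.smul_def, map_smul, ← smul_sub, norm_smul]
  calc ‖(c i : ℝ)‖ * ‖w i - p.adjoint (p (w i))‖ ≤ ‖(c i : ℝ)‖ * (ε * ‖p (w i)‖) := by gcongr
    _ = ε * (‖(c i : ℝ)‖ * ‖p (w i)‖) := by ring

theorem IsHorizAt.approxTan_subset (hp : p ∘L p.adjoint = ContinuousLinearMap.id ℝ (Eucl d))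
    (hν : ∀ E : Set (Eucl d), MeasurableSet E → ν (p ⁻¹' E) ≤ volume E)
    (hy : IsHorizAt p ν y) : approxTan d ν y ⊆ range p.adjoint := by
  intro v hv
  have h : ∀ ε > 0, ‖v - p.adjoint (p v)‖ ≤ ε * ‖p v‖ := fun ε hε =>
    posTangentConeAt_horizCone_subset p ε y
      (mem_iInter₂.1 hv _ (hy.hasDensity_compl_horizCone hp hν hε))
  have h0 : ‖v - p.adjoint (p v)‖ ≤ 0 := by
    have hlim : Tendsto (fun ε : ℝ => ε * ‖p v‖) (𝓝[>] 0) (𝓝 0) := by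
      have : Tendsto (fun ε : ℝ => ε * ‖p v‖) (𝓝 0) (𝓝 (0 * ‖p v‖)) := tendsto_id.mul_const _
      rw [zero_mul] at this
      exact this.mono_left nhdsWithin_le_nhds
    exact ge_of_tendsto hlim (by filter_upwards [self_mem_nhdsWithin] with ε hε using h ε hε)
  exact ⟨p v, (sub_eq_zero.1 (norm_le_zero_iff.1 h0)).symm⟩

/-- If `A` missed the target, all cone mass over the ball of radius `δ * t` about `p y + t • ξ`
would lie in `Aᶜ` and be negligible. Removing that ball from the shadow would then cost more mass
than the full density at `y` permits. -/
theorem IsHorizAt.eventually_exists_near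
    (hp : p ∘L p.adjoint = ContinuousLinearMap.id ℝ (Eucl d))
    (hν : ∀ E : Set (Eucl d), MeasurableSet E → ν (p ⁻¹' E) ≤ volume E)
    (hy : IsHorizAt p ν y) {A : Set (Eucl n)} (hA : HasDensity d (ν.restrict Aᶜ) y 0)
    (ξ : Eucl d) {δ : ℝ} (hδ : 0 < δ) :
    ∀ᶠ t in 𝓝[>] (0 : ℝ), ∃ x ∈ A,
      ‖(x - y) - t • p.adjoint ξ‖ ≤ δ * (‖ξ‖ + δ + 1) * t := by
  have hpos := unitBallVol_pos d
  set ρ := ‖ξ‖ + δ with hρ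
  have hρ0 : 0 < ρ := by positivity
  set c := (1 + δ) * ρ with hc
  have hc0 : 0 < c := by positivity
  set η := δ ^ d / (2 * (c ^ d + ρ ^ d)) with hη
  have hη0 : 0 < η := by positivity
  have hηlt : η * (c ^ d + ρ ^ d) < δ ^ d := by
    have : η * (c ^ d + ρ ^ d) = δ ^ d / 2 := by rw [hη]; field_simp
    rw [this]; exact half_lt_self (by positivity)
  rw [← ENNReal.ofReal_zero, hasDensity_iff d _ y le_rfl] at hA
  filter_upwards [(tendsto_mul_nhdsGT_zero hc0).eventually (hA.eventually (gt_mem_nhds hη0)),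
    (tendsto_mul_nhdsGT_zero hρ0).eventually (hy δ hδ η hη0), self_mem_nhdsWithin] with t h1 h2 ht
  have ht0 : (0 : ℝ) < t := ht
  rw [div_lt_iff₀ (by positivity), measureReal_restrict_apply measurableSet_closedBall] at h1
  set B := closedBall (p y) (ρ * t) with hB
  set B' := closedBall (p y + t • ξ) (δ * t) with hB'
  have hB'B : B' ⊆ B := by
    refine closedBall_subset_closedBall' ?_
    rw [dist_self_add_left, norm_smul, Real.norm_eq_abs, abs_of_pos ht0, hρ]
    linarith
  have hnear : ∀ x ∈ p ⁻¹' B' ∩ horizCone p δ y,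
      ‖(x - y) - t • p.adjoint ξ‖ ≤ δ * (ρ + 1) * t := by
    rintro x ⟨hx1, hx2⟩
    have h3 : ‖(x - y) - p.adjoint (p (x - y))‖ ≤ δ * ‖p (x - y)‖ := hx2
    have h4 : ‖p (x - y)‖ ≤ ρ * t := by
      have := hB'B hx1
      rwa [hB, mem_closedBall, dist_eq_norm, ← map_sub] at this
    have h5 : ‖p.adjoint (p (x - y) - t • ξ)‖ ≤ δ * t := by
      have : ‖p x - (p y + t • ξ)‖ ≤ δ * t := by simpa [hB', dist_eq_norm] using hx1
      rwa [norm_adjoint hp, map_sub, sub_sub]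
    have h6 : (x - y) - t • p.adjoint ξ
        = ((x - y) - p.adjoint (p (x - y))) + p.adjoint (p (x - y) - t • ξ) := by
      rw [map_sub p.adjoint, map_smul]; abel
    rw [h6]
    refine (norm_add_le _ _).trans ?_
    nlinarith
  by_contra hcon
  push Not at hcon
  have hsub : p ⁻¹' B' ∩ horizCone p δ y ⊆ closedBall y (c * t) ∩ Aᶜ := by
    intro x hx
    refine ⟨mem_closedBall.2 ((dist_le_of_mem_horizCone hp hx.2).trans ?_),
      fun hxA => (hcon x hxA).not_ge (hnear x hx)⟩
    have : dist (p x) (p y) ≤ ρ * t := hB'B hx.1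
    calc (1 + δ) * dist (p x) (p y) ≤ (1 + δ) * (ρ * t) := by gcongr
      _ = c * t := by rw [hc]; ring
  have h3 : ν.real (p ⁻¹' B ∩ horizCone p δ y) ≤
      ν.real (p ⁻¹' B' ∩ horizCone p δ y) + ν.real (p ⁻¹' (B \ B')) := by
    refine (measureReal_mono ?_).trans (measureReal_union_le _ _)
    rintro x ⟨hx1, hx2⟩
    by_cases hx : p x ∈ B'
    · exact Or.inl ⟨hx, hx2⟩
    · exact Or.inr ⟨hx1, hx⟩
  have h4 : ν.real (p ⁻¹' (B \ B')) ≤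
      unitBallVol d * (ρ * t) ^ d - unitBallVol d * (δ * t) ^ d := by
    refine (measureReal_preimage_le hν (measurableSet_closedBall.diff measurableSet_closedBall)
      (ne_top_of_le_ne_top measure_closedBall_lt_top.ne (measure_mono sdiff_subset))).trans ?_
    rw [measureReal_sdiff hB'B measurableSet_closedBall measure_closedBall_lt_top.ne,
      measureReal_closedBall_eq _ (by positivity), measureReal_closedBall_eq _ (by positivity)]
  have h5 := measureReal_mono (μ := ν) hsub
  have h6 : 0 < unitBallVol d * t ^ d := by positivity
  rw [mul_pow] at h1 h2 h4
  rw [mul_pow] at h4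
  nlinarith [mul_lt_mul_of_pos_right hηlt h6]

theorem IsHorizAt.range_subset_approxTan
    (hp : p ∘L p.adjoint = ContinuousLinearMap.id ℝ (Eucl d))
    (hν : ∀ E : Set (Eucl d), MeasurableSet E → ν (p ⁻¹' E) ≤ volume E)
    (hy : IsHorizAt p ν y) : range p.adjoint ⊆ approxTan d ν y := by
  rintro _ ⟨ξ, rfl⟩
  refine mem_iInter₂.2 fun A hA => ?_
  have hex : ∀ k : ℕ, ∃ t : ℝ, ∃ x ∈ A, 0 < t ∧ t < 1 / ((k : ℝ) + 1) ∧
      ‖(x - y) - t • p.adjoint ξ‖ ≤ 1 / ((k : ℝ) + 1) * (‖ξ‖ + 2) * t := by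
    intro k
    have hk : 0 < 1 / ((k : ℝ) + 1) := Nat.one_div_pos_of_nat
    have hk1 : 1 / ((k : ℝ) + 1) ≤ 1 := by
      rw [div_le_one (by positivity)]; linarith [(Nat.cast_nonneg k : (0 : ℝ) ≤ k)]
    obtain ⟨t, ⟨x, hxA, hx⟩, ht1, ht0⟩ := ((hy.eventually_exists_near hp hν hA ξ hk).and
      (((gt_mem_nhds hk).filter_mono nhdsWithin_le_nhds).and self_mem_nhdsWithin)).exists
    have ht0' : (0 : ℝ) < t := ht0
    refine ⟨t, x, hxA, ht0, ht1, hx.trans ?_⟩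
    have : ‖ξ‖ + 1 / ((k : ℝ) + 1) + 1 ≤ ‖ξ‖ + 2 := by linarith
    gcongr
  choose t x hxA ht0 ht1 hx using hex
  have hk := tendsto_one_div_add_atTop_nhds_zero_nat (𝕜 := ℝ)
  have ht : Tendsto t atTop (𝓝 0) :=
    squeeze_zero (fun k => (ht0 k).le) (fun k => (ht1 k).le) hk
  have hcd : Tendsto (fun k => (t k)⁻¹ • (x k - y)) atTop (𝓝 (p.adjoint ξ)) := by
    rw [tendsto_iff_norm_sub_tendsto_zero]
    have hb : Tendsto (fun k : ℕ => 1 / ((k : ℝ) + 1) * (‖ξ‖ + 2)) atTop (𝓝 0) := by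
      simpa using hk.mul_const (‖ξ‖ + 2)
    refine squeeze_zero (fun _ => norm_nonneg _) (fun k => ?_) hb
    have h1 : (t k)⁻¹ • (x k - y) - p.adjoint ξ = (t k)⁻¹ • ((x k - y) - t k • p.adjoint ξ) := by
      rw [smul_sub _ (x k - y), inv_smul_smul₀ (ht0 k).ne']
    rw [h1, norm_smul, Real.norm_eq_abs, abs_of_pos (inv_pos.2 (ht0 k)),
      inv_mul_le_iff₀ (ht0 k), mul_comm (t k)]
    exact hx k
  refine mem_tangentConeAt_of_seq atTop (fun k => Real.toNNReal (t k)⁻¹) (fun k => x k - y) ?_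
    (Eventually.of_forall fun k => by simpa using hxA k) ?_
  · have h2 := ht.smul hcd
    rw [zero_smul] at h2
    refine h2.congr fun k => ?_
    rw [smul_inv_smul₀ (ht0 k).ne']
  · refine hcd.congr fun k => ?_
    rw [NNReal.smul_def, Real.coe_toNNReal _ (inv_pos.2 (ht0 k)).le]

end

/-- Since `Du = 0` at `z`, the graph near `z` lies in any prescribed horizontal cone, and its area
is at least that of its shadow, which nearly fills small balls at a density point. -/
theorem isHorizAt_graph {p : Eucl n →L[ℝ] Eucl d}
    (hp : p ∘L p.adjoint = ContinuousLinearMap.id ℝ (Eucl d)) {R : Set (Eucl n)}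
    (hR : μHE[d] R ≠ ∞) {W : Set (Eucl d)} {u : Eucl d → Eucl n} (hpu : ∀ z, p (u z) = 0)
    (hWR : ∀ z ∈ W, p.adjoint z + u z ∈ R) {z : Eucl d}
    (hz : Tendsto (fun r => volume (W ∩ closedBall z r) / volume (closedBall z r)) (𝓝[>] 0) (𝓝 1))
    (hu : HasFDerivAt u (0 : Eucl d →L[ℝ] Eucl n) z) :
    IsHorizAt p (μHE[d].restrict R) (p.adjoint z + u z) := by
  intro ε hε η hη
  have hpos := unitBallVol_pos d
  have hpg : ∀ a, p (p.adjoint a + u a) = a := fun a => by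
    rw [map_add, proj_adjoint hp, hpu, add_zero]
  have hev : ∀ᶠ a in 𝓝 z, ‖u a - u z‖ ≤ ε * ‖a - z‖ := by
    simpa using hu.isLittleO.def hε
  obtain ⟨r₀, hr₀, hball⟩ := Metric.nhds_basis_closedBall.eventually_iff.1 hev
  have hlt : ENNReal.ofReal (1 - η) < 1 := by
    rw [ENNReal.ofReal_lt_one]; linarith
  filter_upwards [hz.eventually (lt_mem_nhds hlt), self_mem_nhdsWithin,
    (gt_mem_nhds hr₀).filter_mono nhdsWithin_le_nhds] with r hr hr0 hrr
  have hr0' : (0 : ℝ) < r := hr0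
  have hsub : W ∩ closedBall z r ⊆ p '' ((p ⁻¹' closedBall (p (p.adjoint z + u z)) r ∩
      horizCone p ε (p.adjoint z + u z)) ∩ R) := by
    rintro a ⟨haW, har⟩
    refine ⟨p.adjoint a + u a, ⟨⟨?_, ?_⟩, hWR a haW⟩, hpg a⟩
    · rw [mem_preimage, hpg, hpg]; exact har
    · have h1 := hball (closedBall_subset_closedBall hrr.le har)
      have h2 : p (p.adjoint a + u a - (p.adjoint z + u z)) = a - z := by
        rw [map_sub, hpg, hpg]
      rw [horizCone, mem_ofPred_eq, h2, map_sub]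
      convert h1 using 2
      abel
  have hm : MeasurableSet (p ⁻¹' closedBall (p (p.adjoint z + u z)) r ∩
      horizCone p ε (p.adjoint z + u z)) :=
    (p.continuous.measurable measurableSet_closedBall).inter
      (isClosed_horizCone p ε _).measurableSet
  have hfin : μHE[d] ((p ⁻¹' closedBall (p (p.adjoint z + u z)) r ∩
      horizCone p ε (p.adjoint z + u z)) ∩ R) ≠ ∞ :=
    ne_top_of_le_ne_top hR (measure_mono inter_subset_right)
  rw [measureReal_restrict_apply hm, ← measureReal_closedBall_eq z hr0'.le]
  have h3 := (measure_mono hsub).trans (volume_proj_image_le hp _)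
  have hb0 : volume (closedBall z r) ≠ 0 := (measure_closedBall_pos _ _ hr0').ne'
  have hbt : volume (closedBall z r) ≠ ∞ := measure_closedBall_lt_top.ne
  rw [ENNReal.lt_div_iff_mul_lt (Or.inl hb0) (Or.inl hbt)] at hr
  have h4 := ENNReal.toReal_mono hfin (hr.le.trans h3)
  rw [ENNReal.toReal_mul] at h4
  refine le_trans ?_ h4
  -- `ENNReal.ofReal` truncates `1 - η` at 0, which covers `η ≥ 1`.
  rw [ENNReal.toReal_ofReal']
  exact mul_le_mul_of_nonneg_right (le_max_left _ _) ENNReal.toReal_nonneg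

end AlmgrenElliptic

namespace AlmgrenElliptic

/-! ### Rectifiable sets whose area equals that of their shadow -/

variable {n d : ℕ} {p : Eucl n →L[ℝ] Eucl d}

/-- All exceptional points have null shadow, and `hν` turns a null shadow into null area; this also
disposes of the vertical parts of `R`. -/
theorem IsRectifiable.ae_isHorizAt (hp : p ∘L p.adjoint = ContinuousLinearMap.id ℝ (Eucl d))
    {R : Set (Eucl n)} (hR : MeasurableSet R) (hrect : IsRectifiable d R)
    (hν : ∀ E : Set (Eucl d), MeasurableSet E → μHE[d] (R ∩ p ⁻¹' E) ≤ volume E) :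
    ∀ᵐ y ∂μHE[d].restrict R, IsHorizAt p (μHE[d].restrict R) y := by
  obtain ⟨W, u, hWm, hul, hpu, hWR, hnull⟩ := hrect.exists_graph_cover hp hR
  choose K hK using hul
  have hpg : ∀ j a, p (p.adjoint a + u j a) = a := fun j a => by
    rw [map_add, proj_adjoint hp, hpu, add_zero]
  have hgood : ∀ j, ∀ᵐ z ∂volume.restrict (W j),
      IsHorizAt p (μHE[d].restrict R) (p.adjoint z + u j z) := by
    intro j
    have hW : ∀ s ⊆ W j, MeasurableSet s →
        μHE[d] ((fun z => p.adjoint z + u j z) '' s) ≤ volume s := by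
      intro s hs hsm
      refine (measure_mono ?_).trans (hν s hsm)
      rintro _ ⟨a, ha, rfl⟩
      exact ⟨hWR j a (hs ha), by rw [mem_preimage, hpg]; exact ha⟩
    filter_upwards [Besicovitch.ae_tendsto_measure_inter_div volume (W j),
      ae_hasFDerivAt_zero hp (hWm j) (hK j) (hpu j) hW] with z hz1 hz2
    exact isHorizAt_graph hp hrect.1.ne (hpu j) (hWR j) hz1 hz2
  have hbad : ∀ j, volume
      {z | z ∈ W j ∧ ¬ IsHorizAt p (μHE[d].restrict R) (p.adjoint z + u j z)} = 0 := by
    intro j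
    have := (ae_restrict_iff' (hWm j)).1 (hgood j)
    rw [ae_iff] at this
    simpa using this
  have hN := measure_union_null hnull (measure_iUnion_null hbad)
  set N := toMeasurable volume ((p '' (R \ ⋃ j, (fun z => p.adjoint z + u j z) '' W j)) ∪
    ⋃ j, {z | z ∈ W j ∧ ¬ IsHorizAt p (μHE[d].restrict R) (p.adjoint z + u j z)})
  have hN0 : volume N = 0 := by rw [measure_toMeasurable]; exact hN
  have hsub := subset_toMeasurable volume
    ((p '' (R \ ⋃ j, (fun z => p.adjoint z + u j z) '' W j)) ∪
      ⋃ j, {z | z ∈ W j ∧ ¬ IsHorizAt p (μHE[d].restrict R) (p.adjoint z + u j z)})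
  have hRN : μHE[d] (R ∩ p ⁻¹' N) = 0 :=
    le_antisymm ((hν N (measurableSet_toMeasurable _ _)).trans hN0.le) bot_le
  rw [ae_restrict_iff' hR, ae_iff]
  refine measure_mono_null (fun y hy => ?_) hRN
  obtain ⟨hyR, hyb⟩ := Classical.not_imp.1 hy
  refine ⟨hyR, hsub ?_⟩
  by_cases hc : y ∈ ⋃ j, (fun z => p.adjoint z + u j z) '' W j
  · obtain ⟨j, z, hz, rfl⟩ := mem_iUnion.1 hc
    refine Or.inr (mem_iUnion.2 ⟨j, ?_⟩)
    simp only [hpg]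
    exact ⟨hz, hyb⟩
  · exact Or.inl ⟨y, ⟨hyR, hc⟩, rfl⟩

/-! ### Frozen energy of a horizontal set. -/

theorem evalCone_eq {F : Eucl n × Grass n d → ℝ} (y : Eucl n) (T : Grass n d) :
    evalCone F y (T.1 : Set (Eucl n)) = ENNReal.ofReal (F (y, T)) := by
  have h : ∃ T' : Grass n d, (T'.1 : Set (Eucl n)) = T.1 := ⟨T, rfl⟩
  rw [evalCone, dif_pos h]
  have : h.choose = T := Subtype.ext (SetLike.coe_injective h.choose_spec)
  rw [this]

theorem isDSet_of_isCompact {R : Set (Eucl n)} (hR : IsCompact R) (hfin : μHE[d] R < ∞) :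
    IsDSet d R :=
  ⟨le_toOuterMeasure_caratheodory _ _ hR.measurableSet,
    fun _ _ => (measure_mono inter_subset_left).trans_lt hfin⟩

/-- A compact rectifiable set on which the projection `p` preserves area has the energy of a
horizontal set. -/
theorem Phi_frozen_eq (hp : p ∘L p.adjoint = ContinuousLinearMap.id ℝ (Eucl d))
    {R : Set (Eucl n)} (hR : IsCompact R) (hrect : IsRectifiable d R)
    (hν : ∀ E : Set (Eucl d), MeasurableSet E → μHE[d] (R ∩ p ⁻¹' E) ≤ volume E)
    (F : Eucl n × Grass n d → ℝ) (x : Eucl n) {T : Grass n d}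
    (hT : (T.1 : Set (Eucl n)) = range p.adjoint) :
    Phi (frozen F x) R = ENNReal.ofReal (F (x, T)) * μHE[d] R := by
  have hfin : Fact (μHE[d] R < ∞) := ⟨hrect.1⟩
  have hν' : ∀ E : Set (Eucl d), MeasurableSet E →
      (μHE[d].restrict R) (p ⁻¹' E) ≤ volume E := fun E hE => by
    rw [Measure.restrict_apply (p.continuous.measurable hE), inter_comm]
    exact hν E hE
  have hae := hrect.ae_isHorizAt hp hR.measurableSet hν
  have hreg : (regPart d R : Set (Eucl n)) =ᵐ[μHE[d]] R := by
    filter_upwards [(ae_restrict_iff' hR.measurableSet).1 hae] with y hy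
    exact propext ⟨fun h => h.1, fun h => ⟨h, (hy h).hasDensity_one hp hν'⟩⟩
  have hunrect : μHE[d] (unrectPart d R) = 0 := (ae_le_set.1 hreg.symm.le)
  -- As `regPart d R` is almost all of `R`, it may be replaced by `R` inside the approximate tangent
  -- cone too.
  rw [Phi, if_pos (isDSet_of_isCompact hR hrect.1), Measure.restrict_congr_set hreg,
    setLIntegral_measure_zero _ _ hunrect, add_zero, ← setLIntegral_const]
  refine lintegral_congr_ae ?_
  filter_upwards [hae] with y hy
  have htan : approxTan d (μHE[d].restrict R) y = T.1 := by
    rw [hT]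
    exact Subset.antisymm (hy.approxTan_subset hp hν') (hy.range_subset_approxTan hp hν')
  rw [htan, evalCone_eq, frozen]

theorem isRectifiable_adjoint_image (hp : p ∘L p.adjoint = ContinuousLinearMap.id ℝ (Eucl d))
    {P : Set (Eucl d)} (hP : volume P < ∞) : IsRectifiable d (p.adjoint '' P) := by
  refine ⟨by rwa [euclideanHausdorffMeasure_adjoint_image hp],
    fun _ => p.adjoint, fun _ => ⟨1, (isometry_adjoint hp).lipschitz⟩, ?_⟩
  have : p.adjoint '' P \ ⋃ _ : ℕ, range p.adjoint = ∅ := by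
    rw [iUnion_const, sdiff_eq_empty]
    exact image_subset_range _ _
  rw [this, measure_empty]

end AlmgrenElliptic

/-! ### The contradiction. -/

theorem mainTheorem10 (n d : ℕ) (hd : 2 ≤ d) (hdn : d ≤ n)
    (F : AlmgrenElliptic.Eucl n × AlmgrenElliptic.Grass n d → ℝ)
    (hF : AlmgrenElliptic.IsIntegrand F) (x : AlmgrenElliptic.Eucl n)
    (R Q : Set (AlmgrenElliptic.Eucl n))
    (hRQ : AlmgrenElliptic.IsCubicalTestPair d R Q)
    (hlt : AlmgrenElliptic.Phi (AlmgrenElliptic.frozen F x) R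
      < AlmgrenElliptic.Phi (AlmgrenElliptic.frozen F x) Q) :
    μHE[d] Q < μHE[d] R := by
  open AlmgrenElliptic in
  obtain ⟨p, hp, rfl, hR, hrect, hB, hret⟩ := hRQ
  by_contra! hle
  have hcube : stdCube d ⊆ p '' R := IsCubicalTestPair.cube_subset_proj hp hR hB hret
  have hvol : volume (stdCube d) < ∞ := (isCompact_stdCube d).measure_lt_top
  have hQ : μHE[d] (p.adjoint '' stdCube d) = volume (stdCube d) :=
    euclideanHausdorffMeasure_adjoint_image hp _
  have hQrect := isRectifiable_adjoint_image hp hvol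
  have hcubeQ : stdCube d ⊆ p '' (p.adjoint '' stdCube d) := fun z hz =>
    ⟨_, ⟨z, hz, rfl⟩, proj_adjoint hp z⟩
  have heq : μHE[d] R = μHE[d] (p.adjoint '' stdCube d) :=
    le_antisymm hle (hQ.le.trans ((measure_mono hcube).trans (volume_proj_image_le hp R)))
  let T : Grass n d := ⟨p.adjoint.toLinearMap.range, by
    rw [LinearMap.finrank_range_of_inj (isometry_adjoint hp).injective,
      finrank_euclideanSpace_fin]⟩
  have hT : (T.1 : Set (Eucl n)) = range p.adjoint := LinearMap.coe_range _
  -- `Q` has the same area as its own shadow, so the energy formula applies to both sets with the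
  -- same `T`.
  rw [Phi_frozen_eq hp hR hrect
      (fun E hE => measure_inter_preimage_le hp hcube (hle.trans hQ.le) hrect.1.ne hE) F x hT,
    Phi_frozen_eq hp ((isCompact_stdCube d).image p.adjoint.continuous) hQrect
      (fun E hE => measure_inter_preimage_le hp hcubeQ hQ.le hQrect.1.ne hE) F x hT, heq] at hlt
  exact lt_irrefl _ hlt
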